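/- Let $\mathcal C$ be a simplicial model category, let $\eta\colon k\to B$ be a morphism of $\mathcal C$, and let $\mathcal C^\eta$ be the category of factorizations $k\to X\to B$ of $\eta$; its initial object is $k$ (that is, $k\xrightarrow{=}k\xrightarrow{\eta}B$), its terminal object is $B$ (that is, $k\xrightarrow{\eta}B\xrightarrow{=}B$), and its binary coproducts are the pushouts $X\otimes_k Y=X\amalg_k Y$. Let $R$ be a commutative ring and $\mathrm{Ch}(R)$ the category of unbounded chain complexes of $R$-modules. Write $U\simeq V$ if $U$ and $V$ are connected by a finite zigzag of quasi-isomorphisms. For a chain map $f\colon U\to V$ let $\mathrm{hofib}(f)$ be the complex with $\mathrm{hofib}(f)_n=U_n\oplus V_{n+1}$ and $d(u,v)=(du,\,-f(u)-dv)$. For a functor $F\colon\mathcal C^\eta\to\mathrm{Ch}(R)$ and objects $X_1,X_2$ of $\mathcal C^\eta$, the second cross effect $cr_2F(X_1,X_2)$ is the iterated homotopy fiber of the square formed by $F$ on $X_1\amalg_kX_2$, $B\amalg_kX_2$, $X_1\amalg_kB$, $B\amalg_kB$, i.e. the $\mathrm{hofib}$ of the induced chain map $$\mathrm{hofib}\bigl(F(X_1\amalg_kX_2)\to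 F(B\amalg_kX_2)\bigr)\longrightarrow\mathrm{hofib}\bigl(F(X_1\amalg_kB)\to F(B\amalg_kB)\bigr).$$ Suppose that $F\colon\mathcal C^\eta\to\mathrm{Ch}(R)$ is reduced, i.e. $F(B)\simeq 0$, and of degree $1$, i.e. $cr_2F(X_1,X_2)\simeq 0$ for all objects $X_1,X_2$ of $\mathcal C^\eta$. Then there is a weak equivalence of chain complexes $$F(k)\simeq\Omega F(B\otimes_kB),$$ where $\Omega$ shifts a complex down one degree: $(\Omega X)_n=X_{n+1}$, with differential $-d_X$. -/

import Mathlib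

open CategoryTheory Limits HomotopicalAlgebra MonoidalCategory

universe v u w r

noncomputable section

namespace DiscreteCalculus

/-! ## Simplicial model categories -/

section SimplicialModel

open SimplicialCategory

variable {C : Type u} [Category.{v} C] [SimplicialCategory C]

/-- The map `Map(T, Y) ⟶ Map(X, Y)^K` of simplicial sets induced by `e : K ⟶ Map(X, T)`. -/
def tensorComparison {K : SSet.{v}} {X T : C} (e : K ⟶ sHom X T) (Y : C) :
    sHom T Y ⟶ (ihom K).obj (sHom X Y) :=
  MonoidalClosed.curry (e ▷ sHom T Y ≫ sHomComp X T Y)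

/-- The map `Map(X, P) ⟶ Map(X, Y)^K` of simplicial sets induced by `e : K ⟶ Map(P, Y)`. -/
def cotensorComparison {K : SSet.{v}} {P Y : C} (e : K ⟶ sHom P Y) (X : C) :
    sHom X P ⟶ (ihom K).obj (sHom X Y) :=
  MonoidalClosed.curry ((β_ K (sHom X P)).hom ≫ sHom X P ◁ e ≫ sHomComp X P Y)

/-- The map `Map(B, X) ⟶ Map(A, X) ×_{Map(A, Y)} Map(B, Y)` induced by `i : A ⟶ B` and
`p : X ⟶ Y`. -/
def pullbackHom {A B X Y : C} (i : A ⟶ B) (p : X ⟶ Y) :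
    sHom B X ⟶ pullback (eHomWhiskerLeft SSet.{v} A p) (eHomWhiskerRight SSet.{v} i Y) :=
  pullback.lift (eHomWhiskerRight SSet.{v} i X) (eHomWhiskerLeft SSet.{v} B p)
    (eHom_whisker_exchange SSet.{v} i p).symm

/-- A simplicial model category: a model category enriched over simplicial sets which is tensored
and cotensored over simplicial sets and satisfies Quillen's axiom SM7. Kan fibrations are the maps
with the right lifting property against all horn inclusions (the class `J`), and trivial Kan
fibrations those with the right lifting property against all boundary inclusions (the
class `I`). -/
class SimplicialModelCategory (C : Type u) [Category.{v} C] [ModelCategory C]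
    [SimplicialCategory C] : Prop where
  exists_tensor (K : SSet.{v}) (X : C) :
    ∃ (T : C) (e : K ⟶ sHom X T), ∀ Y : C, IsIso (tensorComparison e Y)
  exists_cotensor (K : SSet.{v}) (Y : C) :
    ∃ (P : C) (e : K ⟶ sHom P Y), ∀ X : C, IsIso (cotensorComparison e X)
  fibration_pullbackHom {A B X Y : C} (i : A ⟶ B) (p : X ⟶ Y) :
    Cofibration i → Fibration p → SSet.modelCategoryQuillen.J.rlp (pullbackHom i p)
  trivialFibration_pullbackHom {A B X Y : C} (i : A ⟶ B) (p : X ⟶ Y) :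
    Cofibration i → Fibration p → (WeakEquivalence i ∨ WeakEquivalence p) →
      SSet.modelCategoryQuillen.I.rlp (pullbackHom i p)

end SimplicialModel

/-! ## Unbounded chain complexes -/

section Complexes

variable (R : Type r) [CommRing R]

/-- Unbounded chain complexes of `R`-modules; the differential lowers the degree by one. -/
abbrev Ch := ChainComplex (ModuleCat.{w} R) ℤ

variable {R}

/-- Two chain complexes are weakly equivalent if they are connected by a finite zigzag of
quasi-isomorphisms. -/
def WeaklyEquivalent (X Y : Ch.{w} R) : Prop :=
  Relation.EqvGen (fun X Y : Ch.{w} R => ∃ f : X ⟶ Y, QuasiIso f) X Y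

/-- The shift `(Ω X)_k = X_{k+1}`, with differential `-d`. -/
def loops (X : Ch.{w} R) : Ch.{w} R where
  X k := X.X (k + 1)
  d i j := -X.d (i + 1) (j + 1)
  shape i j h := by
    rw [X.shape, neg_zero]
    intro h'
    exact h (by simp only [ComplexShape.down_Rel] at h' ⊢; omega)
  d_comp_d' i j k _ _ := by simp

/-- The differential of the homotopy fiber, `d (u, v) = (d u, - f u - d v)`. -/
def hofibD {U V : Ch.{w} R} (f : U ⟶ V) (n : ℤ) :
    ModuleCat.of R (U.X (n + 1) × V.X (n + 1 + 1)) ⟶ ModuleCat.of R (U.X n × V.X (n + 1)) :=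
  ModuleCat.ofHom
    (((U.d (n + 1) n).hom ∘ₗ LinearMap.fst R _ _).prod
      (-((f.f (n + 1)).hom ∘ₗ LinearMap.fst R _ _) -
        (V.d (n + 1 + 1) (n + 1)).hom ∘ₗ LinearMap.snd R _ _))

theorem hofibD_comp {U V : Ch.{w} R} (f : U ⟶ V) (n : ℤ) :
    hofibD f (n + 1) ≫ hofibD f n = 0 := by
  have hU (x) : (U.d (n + 1) n).hom ((U.d (n + 1 + 1) (n + 1)).hom x) = 0 := by
    rw [← LinearMap.comp_apply, ← ModuleCat.hom_comp, U.d_comp_d]; rfl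
  have hV (x) : (V.d (n + 1 + 1) (n + 1)).hom ((V.d (n + 1 + 1 + 1) (n + 1 + 1)).hom x) = 0 := by
    rw [← LinearMap.comp_apply, ← ModuleCat.hom_comp, V.d_comp_d]; rfl
  have hf (x) : (f.f (n + 1)).hom ((U.d (n + 1 + 1) (n + 1)).hom x) =
      (V.d (n + 1 + 1) (n + 1)).hom ((f.f (n + 1 + 1)).hom x) := by
    rw [← LinearMap.comp_apply, ← ModuleCat.hom_comp, ← f.comm]; rfl
  ext x <;> simp [hofibD, hU, hV, hf]

/-- The homotopy fiber of a chain map `f : U ⟶ V`: in degree `n` it is `U_n ⊕ V_{n+1}`, with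
differential `d (u, v) = (d u, - f u - d v)`. -/
def hofib {U V : Ch.{w} R} (f : U ⟶ V) : Ch.{w} R :=
  ChainComplex.of (fun n => ModuleCat.of R (U.X n × V.X (n + 1))) (hofibD f) (hofibD_comp f)

/-- The chain map `hofib f ⟶ hofib g`, `(u, v) ↦ (a u, b v)`, induced by a commutative square. -/
def hofibMap {U V U' V' : Ch.{w} R} (f : U ⟶ V) (g : U' ⟶ V') (a : U ⟶ U') (b : V ⟶ V')
    (h : f ≫ b = a ≫ g) : hofib f ⟶ hofib g :=
  ChainComplex.ofHom
    (X := hofib f) (Y := hofib g)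
    (fun n => ModuleCat.ofHom (LinearMap.prodMap (a.f n).hom (b.f (n + 1)).hom))
    (fun n => by
      have ha (x) : (U'.d (n + 1) n).hom ((a.f (n + 1)).hom x) =
          (a.f n).hom ((U.d (n + 1) n).hom x) := by
        rw [← LinearMap.comp_apply, ← ModuleCat.hom_comp, a.comm]; rfl
      have hb (x) : (V'.d (n + 1 + 1) (n + 1)).hom ((b.f (n + 1 + 1)).hom x) =
          (b.f (n + 1)).hom ((V.d (n + 1 + 1) (n + 1)).hom x) := by
        rw [← LinearMap.comp_apply, ← ModuleCat.hom_comp, b.comm]; rfl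
      have hh (x) : (g.f (n + 1)).hom ((a.f (n + 1)).hom x) =
          (b.f (n + 1)).hom ((f.f (n + 1)).hom x) := by
        have := congrArg (fun t : U ⟶ V' => (t.f (n + 1)).hom x) h
        exact this.symm
      simp only [hofib, ChainComplex.of_d]
      apply ModuleCat.hom_ext
      apply LinearMap.ext
      rintro ⟨x, y⟩
      refine Prod.ext ?_ ?_
      · exact ha x
      · change -(g.f (n + 1)).hom ((a.f (n + 1)).hom x) -
            (V'.d (n + 1 + 1) (n + 1)).hom ((b.f (n + 1 + 1)).hom y) =
          (b.f (n + 1)).hom (-(f.f (n + 1)).hom x - (V.d (n + 1 + 1) (n + 1)).hom y)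
        rw [hh, hb, map_sub, map_neg])

/-- The iterated homotopy fiber of a commutative square with top `f : P ⟶ Q`, left `a : P ⟶ S`,
right `b : Q ⟶ T` and bottom `g : S ⟶ T`. -/
def ifiber {P Q S T : Ch.{w} R} (f : P ⟶ Q) (g : S ⟶ T) (a : P ⟶ S) (b : Q ⟶ T)
    (h : f ≫ b = a ≫ g) : Ch.{w} R :=
  hofib (hofibMap f g a b h)

end Complexes

/-! ## Factorizations of a morphism and cross effects -/

section CrossEffects

variable {C : Type u} [Category.{v} C] [HasPushouts C] {k B : C} {η : k ⟶ B}

/-- The coproduct `X ⨿_k Y` of two factorizations of `η : k ⟶ B`, with its structure maps from `k`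
and to `B`. -/
def coprodUnder (X Y : Factorisation η) : Factorisation η where
  mid := pushout X.ι Y.ι
  ι := X.ι ≫ pushout.inl X.ι Y.ι
  π := pushout.desc X.π Y.π (by simp)
  ι_π := by rw [Category.assoc, pushout.inl_desc, X.ι_π]

/-- The morphism of `C` underlying `coprodUnderMap`. -/
def pushoutMap {X X' Y Y' : Factorisation η} (p : X ⟶ X') (q : Y ⟶ Y') :
    pushout X.ι Y.ι ⟶ pushout X'.ι Y'.ι :=
  pushout.desc (p.h ≫ pushout.inl X'.ι Y'.ι) (q.h ≫ pushout.inr X'.ι Y'.ι)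
    (by rw [p.ι_h_assoc, q.ι_h_assoc, pushout.condition])

theorem inl_pushoutMap {X X' Y Y' : Factorisation η} (p : X ⟶ X') (q : Y ⟶ Y') :
    pushout.inl X.ι Y.ι ≫ pushoutMap p q = p.h ≫ pushout.inl X'.ι Y'.ι :=
  pushout.inl_desc _ _ _

theorem inr_pushoutMap {X X' Y Y' : Factorisation η} (p : X ⟶ X') (q : Y ⟶ Y') :
    pushout.inr X.ι Y.ι ≫ pushoutMap p q = q.h ≫ pushout.inr X'.ι Y'.ι :=
  pushout.inr_desc _ _ _

theorem pushoutMap_comp {X X' X'' Y Y' Y'' : Factorisation η} (p : X ⟶ X') (p' : X' ⟶ X'')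
    (q : Y ⟶ Y') (q' : Y' ⟶ Y'') :
    pushoutMap p q ≫ pushoutMap p' q' = pushoutMap (p ≫ p') (q ≫ q') := by
  apply pushout.hom_ext
  · rw [reassoc_of% (inl_pushoutMap p q), inl_pushoutMap, inl_pushoutMap,
      Factorisation.comp_h, Category.assoc]
  · rw [reassoc_of% (inr_pushoutMap p q), inr_pushoutMap, inr_pushoutMap,
      Factorisation.comp_h, Category.assoc]

/-- The map `X ⨿_k Y ⟶ X' ⨿_k Y'` induced by maps `X ⟶ X'` and `Y ⟶ Y'`. -/
def coprodUnderMap {X X' Y Y' : Factorisation η} (p : X ⟶ X') (q : Y ⟶ Y') :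
    coprodUnder X Y ⟶ coprodUnder X' Y' where
  h := pushoutMap p q
  ι_h := by
    change (X.ι ≫ pushout.inl X.ι Y.ι) ≫ _ = X'.ι ≫ pushout.inl X'.ι Y'.ι
    rw [Category.assoc, inl_pushoutMap, p.ι_h_assoc]
  h_π := by
    change pushoutMap p q ≫ pushout.desc X'.π Y'.π _ = pushout.desc X.π Y.π _
    apply pushout.hom_ext
    · rw [reassoc_of% (inl_pushoutMap p q), pushout.inl_desc, pushout.inl_desc, p.h_π]
    · rw [reassoc_of% (inr_pushoutMap p q), pushout.inr_desc, pushout.inr_desc, q.h_π]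

theorem coprodUnderMap_comp {X X' X'' Y Y' Y'' : Factorisation η} (p : X ⟶ X') (p' : X' ⟶ X'')
    (q : Y ⟶ Y') (q' : Y' ⟶ Y'') :
    coprodUnderMap p q ≫ coprodUnderMap p' q' = coprodUnderMap (p ≫ p') (q ≫ q') :=
  Factorisation.Hom.ext (pushoutMap_comp p p' q q')

variable {R : Type r} [CommRing R]

/-- The second cross effect `cr₂ F (X₁, X₂)`: the iterated homotopy fiber of the square
```
F (X₁ ⨿_k X₂) ⟶ F (B ⨿_k X₂)
      |               |
F (X₁ ⨿_k B)  ⟶ F (B ⨿_k B)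
```
where `Factorisation.terminal` is `k ⟶ B = B`. -/
def crossEffect₂ (F : Factorisation η ⥤ Ch.{w} R) (X₁ X₂ : Factorisation η) : Ch.{w} R :=
  ifiber
    (F.map (coprodUnderMap X₁.terminalHom (𝟙 X₂)))
    (F.map (coprodUnderMap X₁.terminalHom (𝟙 Factorisation.terminal)))
    (F.map (coprodUnderMap (𝟙 X₁) X₂.terminalHom))
    (F.map (coprodUnderMap (𝟙 Factorisation.terminal) X₂.terminalHom))
    (by
      rw [← F.map_comp, ← F.map_comp, coprodUnderMap_comp, coprodUnderMap_comp]
      simp only [Category.id_comp]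
      erw [Category.comp_id, Category.comp_id])

open scoped ZeroObject in
/-- `F` is reduced: `F(B) ≃ 0`. -/
def IsReduced (F : Factorisation η ⥤ Ch.{w} R) : Prop :=
  WeaklyEquivalent (F.obj Factorisation.terminal) 0

open scoped ZeroObject in
/-- `F` is of degree `1`: all its second cross effects are weakly equivalent to `0`. -/
def IsDegreeOne (F : Factorisation η ⥤ Ch.{w} R) : Prop :=
  ∀ X₁ X₂ : Factorisation η, WeaklyEquivalent (crossEffect₂ F X₁ X₂) 0

end CrossEffects

end DiscreteCalculus

end

namespace DiscreteCalculus

/-! ### Acyclicity, quasi-isomorphisms and homotopy fibers, elementwise. -/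

section Complexes

variable {R : Type r} [CommRing R]

/-! Take `X₁ = X₂ = k` in the cross effect. Since `k` is a unit for `⨿_k`, the square has corners
`F(k)`, `F(B)`, `F(B)`, `F(B ⨿_k B)` up to isomorphism, and the two middle ones are acyclic because
`F` is reduced. Hence the top fiber projects to `F(k)` by a quasi-isomorphism (`quasiIso_hofibFst`),
the bottom fiber receives one from `Ω F(B ⨿_k B)` (`quasiIso_hofibInr`), and acyclicity of `cr₂`
makes the map between the fibers one (`quasiIso_of_isExact_hofib`). Direct chases in the explicit
model of `hofib` replace long exact sequences. -/

theorem hom_d_apply {X Y : Ch.{w} R} (f : X ⟶ Y) (i j : ℤ) (x : X.X i) :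
    f.f j (X.d i j x) = Y.d i j (f.f i x) := by
  rw [← ModuleCat.comp_apply, ← ModuleCat.comp_apply, f.comm]

/-- Every cycle is a boundary. -/
def IsExact (X : Ch.{w} R) : Prop :=
  ∀ (n : ℤ) (x : X.X (n + 1)), X.d (n + 1) n x = 0 → ∃ y, X.d (n + 1 + 1) (n + 1) y = x

theorem isExact_iff_acyclic (X : Ch.{w} R) : IsExact X ↔ X.Acyclic := by
  have key (n : ℤ) : X.ExactAt (n + 1) ↔
      ∀ x : X.X (n + 1), X.d (n + 1) n x = 0 → ∃ y, X.d (n + 1 + 1) (n + 1) y = x := by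
    rw [X.exactAt_iff' (n + 1 + 1) (n + 1) n (by simp) (by simp),
      ShortComplex.moduleCat_exact_iff]
    rfl
  refine ⟨fun h i => ?_, fun h n => (key n).1 (h _)⟩
  obtain ⟨n, rfl⟩ : ∃ n, i = n + 1 := ⟨i - 1, by omega⟩
  exact (key n).2 (h n)

/-- Each quasi-isomorphism of the zigzag identifies homology, in whichever direction it points. -/
theorem WeaklyEquivalent.acyclic_iff {X Y : Ch.{w} R} (h : WeaklyEquivalent X Y) :
    X.Acyclic ↔ Y.Acyclic := by
  induction h with
  | rel X Y h =>
    obtain ⟨f, hf⟩ := h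
    simp only [HomologicalComplex.Acyclic, HomologicalComplex.exactAt_iff_isZero_homology]
    exact forall_congr' fun i => (asIso (HomologicalComplex.homologyMap f i)).isZero_iff
  | refl => rfl
  | symm _ _ _ h => exact h.symm
  | trans _ _ _ _ _ h₁ h₂ => exact h₁.trans h₂

open scoped ZeroObject in
theorem WeaklyEquivalent.isExact {X : Ch.{w} R} (h : WeaklyEquivalent X 0) : IsExact X := by
  rw [isExact_iff_acyclic, h.acyclic_iff]
  intro i
  exact ShortComplex.exact_of_isZero_X₂ _
    ((HomologicalComplex.eval _ _ i).map_isZero (isZero_zero _))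

theorem homologyπ_surjective (X : Ch.{w} R) (i : ℤ) (z : X.homology i) :
    ∃ y, X.homologyπ i y = z :=
  (ModuleCat.epi_iff_surjective (X.homologyπ i)).1 inferInstance z

/-- Homology is the cokernel of `toCycles`, and injectivity of `iCycles` lets the boundary be tested
in `X` itself. -/
theorem homologyπ_eq_zero_iff (X : Ch.{w} R) (n : ℤ) (z : X.cycles (n + 1)) :
    X.homologyπ (n + 1) z = 0 ↔ ∃ y, X.d (n + 1 + 1) (n + 1) y = X.iCycles (n + 1) z := by
  have hinj := (ModuleCat.mono_iff_injective (X.iCycles (n + 1))).1 inferInstance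
  have hd (y) : X.iCycles (n + 1) (X.toCycles (n + 1 + 1) (n + 1) y) =
      X.d (n + 1 + 1) (n + 1) y := by
    rw [← ModuleCat.comp_apply, X.toCycles_i]
  constructor
  · intro h
    have hex := ShortComplex.exact_of_g_is_cokernel
      (ShortComplex.mk (X.toCycles (n + 1 + 1) (n + 1)) (X.homologyπ (n + 1)) (by simp))
      (X.homologyIsCokernel (n + 1 + 1) (n + 1) (by simp))
    obtain ⟨y, hy⟩ := (ShortComplex.moduleCat_exact_iff _).1 hex z h
    refine ⟨y, ?_⟩
    rw [← hd]
    exact congrArg _ hy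
  · rintro ⟨y, hy⟩
    rw [← hd] at hy
    rw [← hinj hy, ← ModuleCat.comp_apply, X.toCycles_comp_homologyπ]
    rfl

theorem d_iCycles_apply (X : Ch.{w} R) (i j : ℤ) (z : X.cycles i) :
    X.d i j (X.iCycles i z) = 0 := by
  rw [← ModuleCat.comp_apply, X.iCycles_d]; rfl

theorem exists_iCycles_eq (X : Ch.{w} R) (n : ℤ) (x : X.X (n + 1)) (hx : X.d (n + 1) n x = 0) :
    ∃ z, X.iCycles (n + 1) z = x := by
  have hex := ShortComplex.exact_of_f_is_kernel
    (ShortComplex.mk (X.iCycles (n + 1)) (X.d (n + 1) n) (by simp))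
    (X.cyclesIsKernel (n + 1) n (by simp))
  exact (ShortComplex.moduleCat_exact_iff _).1 hex x hx

/-- An elementwise criterion for quasi-isomorphisms. -/
theorem quasiIso_of_elements {X Y : Ch.{w} R} (f : X ⟶ Y)
    (hinj : ∀ (n : ℤ) (x : X.X (n + 1)) (y : Y.X (n + 1 + 1)), X.d (n + 1) n x = 0 →
      f.f (n + 1) x = Y.d (n + 1 + 1) (n + 1) y → ∃ x', X.d (n + 1 + 1) (n + 1) x' = x)
    (hsurj : ∀ (n : ℤ) (y : Y.X (n + 1)), Y.d (n + 1) n y = 0 →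
      ∃ x y', X.d (n + 1) n x = 0 ∧ y = f.f (n + 1) x + Y.d (n + 1 + 1) (n + 1) y') :
    QuasiIso f := by
  refine ⟨fun i => ?_⟩
  obtain ⟨n, rfl⟩ : ∃ n, i = n + 1 := ⟨i - 1, by omega⟩
  have hπ (z : X.cycles (n + 1)) : HomologicalComplex.homologyMap f (n + 1)
      (X.homologyπ (n + 1) z) = Y.homologyπ (n + 1) (HomologicalComplex.cyclesMap f (n + 1) z) := by
    rw [← ModuleCat.comp_apply, ← ModuleCat.comp_apply, HomologicalComplex.homologyπ_naturality]
  have hi (z : X.cycles (n + 1)) : Y.iCycles (n + 1) (HomologicalComplex.cyclesMap f (n + 1) z) =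
      f.f (n + 1) (X.iCycles (n + 1) z) := by
    rw [← ModuleCat.comp_apply, ← ModuleCat.comp_apply, HomologicalComplex.cyclesMap_i]
  rw [quasiIsoAt_iff_isIso_homologyMap]
  refine (ConcreteCategory.isIso_iff_bijective _).2 ⟨?_, ?_⟩
  · refine (injective_iff_map_eq_zero _).2 fun a ha => ?_
    obtain ⟨z, rfl⟩ := homologyπ_surjective X (n + 1) a
    rw [hπ, homologyπ_eq_zero_iff] at ha
    obtain ⟨y, hy⟩ := ha
    rw [homologyπ_eq_zero_iff]
    exact hinj n _ y (d_iCycles_apply X _ _ z) (by rw [hy, hi])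
  · intro b
    obtain ⟨z, rfl⟩ := homologyπ_surjective Y (n + 1) b
    obtain ⟨x, y', hx, hy⟩ := hsurj n _ (d_iCycles_apply Y _ _ z)
    obtain ⟨c, rfl⟩ := exists_iCycles_eq X n x hx
    refine ⟨X.homologyπ (n + 1) c, ?_⟩
    rw [hπ, eq_comm, ← sub_eq_zero, ← map_sub, homologyπ_eq_zero_iff]
    refine ⟨y', ?_⟩
    rw [map_sub, hi, hy, add_sub_cancel_left]

variable {U V : Ch.{w} R} (f : U ⟶ V)

theorem hofib_d_apply (n : ℤ) (u : U.X (n + 1)) (v : V.X (n + 1 + 1)) :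
    (hofib f).d (n + 1) n (u, v) =
      (U.d (n + 1) n u, -f.f (n + 1) u - V.d (n + 1 + 1) (n + 1) v) := by
  simp only [hofib, ChainComplex.of_d]
  rfl

/-- The projection `hofib f ⟶ U`. -/
noncomputable def hofibFst : hofib f ⟶ U where
  f n := ModuleCat.ofHom (LinearMap.fst R (U.X n) (V.X (n + 1)))
  comm' i j h := by
    obtain rfl : j + 1 = i := h
    ext ⟨u, v⟩
    exact (congrArg Prod.fst (hofib_d_apply f j u v)).symm

/-- The inclusion `loops V ⟶ hofib f`. -/
noncomputable def hofibInr : loops V ⟶ hofib f where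
  f n := ModuleCat.ofHom (LinearMap.inr R (U.X n) (V.X (n + 1)))
  comm' i j h := by
    obtain rfl : j + 1 = i := h
    ext v
    refine (hofib_d_apply f j 0 v).trans ?_
    rw [map_zero, map_zero, neg_zero, zero_sub]
    rfl

/-- A pair `(x, -y)` is a cycle of the fiber exactly when `dx = 0` and `f x = dy`; injectivity on
homology uses such pairs, surjectivity those with `x = 0`. -/
theorem quasiIso_of_isExact_hofib (h : IsExact (hofib f)) : QuasiIso f := by
  refine quasiIso_of_elements f (fun n x y hx hxy => ?_) fun n y hy => ?_
  · obtain ⟨⟨u, v⟩, huv⟩ := h n (x, -y) (by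
      rw [hofib_d_apply, hx, hxy, map_neg, sub_neg_eq_add, neg_add_cancel]; rfl)
    rw [hofib_d_apply] at huv
    exact ⟨u, congrArg Prod.fst huv⟩
  -- An element of `V` sits one degree lower in the fiber.
  · obtain ⟨n, rfl⟩ : ∃ m, n = m + 1 := ⟨n - 1, by omega⟩
    obtain ⟨⟨u, v⟩, huv⟩ := h n (0, y) (by
      rw [hofib_d_apply, hy, map_zero, map_zero, neg_zero, sub_zero]; rfl)
    rw [hofib_d_apply] at huv
    refine ⟨-u, -v, ?_, ?_⟩
    · rw [map_neg, neg_eq_zero]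
      exact congrArg Prod.fst huv
    · rw [map_neg, map_neg, ← sub_eq_add_neg]
      exact (congrArg Prod.snd huv).symm

theorem quasiIso_hofibFst (h : IsExact V) : QuasiIso (hofibFst f) := by
  refine quasiIso_of_elements _ ?_ fun n u hu => ?_
  · rintro n ⟨u, v⟩ u' huv (hu : u = U.d _ _ u')
    rw [hofib_d_apply] at huv
    have h₂ : -f.f (n + 1) u - V.d (n + 1 + 1) (n + 1) v = 0 := congrArg Prod.snd huv
    -- This is the discrepancy between `(u, v)` and `d(u', 0)`; it is a cycle of `V`, hence a
    -- boundary.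
    obtain ⟨w, hw⟩ := h (n + 1) (v + f.f (n + 1 + 1) u') (by
      rw [map_add, ← hom_d_apply, ← hu, ← neg_eq_zero, ← h₂]; abel)
    refine ⟨(u', -w), ?_⟩
    rw [hofib_d_apply]
    refine Prod.ext hu.symm ?_
    change -f.f (n + 1 + 1) u' - V.d (n + 1 + 1 + 1) (n + 1 + 1) (-w) = v
    rw [map_neg, hw]
    abel
  · obtain ⟨v, hv⟩ := h n (f.f (n + 1) u) (by rw [← hom_d_apply, hu, map_zero])
    refine ⟨(u, -v), 0, ?_, ?_⟩
    · rw [hofib_d_apply, hu, map_neg, hv, sub_neg_eq_add, neg_add_cancel]; rfl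
    · rw [map_zero, add_zero]; rfl

theorem quasiIso_hofibInr (h : IsExact U) : QuasiIso (hofibInr f) := by
  refine quasiIso_of_elements _ ?_ ?_
  · rintro n v ⟨u', v'⟩ - (hv : ((0 : U.X (n + 1)), v) = _)
    rw [hofib_d_apply] at hv
    obtain ⟨u, hu⟩ := h (n + 1) u' (congrArg Prod.fst hv).symm
    have h₂ : v = -f.f (n + 1 + 1) u' - V.d (n + 1 + 1 + 1) (n + 1 + 1) v' := congrArg Prod.snd hv
    -- With `u' = du`, `v = -f u' - dv' = -d(f u + v')`, and `-d` is the differential of `loops V`.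
    refine ⟨f.f (n + 1 + 1 + 1) u + v', ?_⟩
    change -(V.d (n + 1 + 1 + 1) (n + 1 + 1) (f.f (n + 1 + 1 + 1) u + v')) = v
    rw [map_add, ← hom_d_apply, hu, h₂]
    abel
  · rintro n ⟨u, v⟩ huv
    rw [hofib_d_apply] at huv
    have h₂ : -f.f (n + 1) u - V.d (n + 1 + 1) (n + 1) v = 0 := congrArg Prod.snd huv
    obtain ⟨u', hu'⟩ := h n u (congrArg Prod.fst huv)
    -- Subtracting `d(u', 0)` clears the `U`-component of `(u, v)`.
    refine ⟨v + f.f (n + 1 + 1) u', (u', 0), ?_, ?_⟩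
    · change -(V.d (n + 1 + 1) (n + 1) (v + f.f (n + 1 + 1) u')) = 0
      rw [map_add, ← hom_d_apply, hu', ← h₂]
      abel
    · rw [hofib_d_apply, hu', map_zero, sub_zero]
      refine Prod.ext (zero_add u).symm ?_
      change v = (v + f.f (n + 1 + 1) u') + -f.f (n + 1 + 1) u'
      abel

theorem weaklyEquivalent_of_quasiIso {X Y : Ch.{w} R} (f : X ⟶ Y) (hf : QuasiIso f) :
    WeaklyEquivalent X Y :=
  .rel _ _ ⟨f, hf⟩

theorem weaklyEquivalent_of_iso {X Y : Ch.{w} R} (e : X ≅ Y) : WeaklyEquivalent X Y :=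
  weaklyEquivalent_of_quasiIso e.hom inferInstance

/-- If the iterated homotopy fiber of a square and its two off-diagonal corners are acyclic, the
initial corner is equivalent to the loops of the final one. -/
theorem weaklyEquivalent_loops_of_ifiber {P Q S T : Ch.{w} R} (f : P ⟶ Q) (g : S ⟶ T) (a : P ⟶ S)
    (b : Q ⟶ T) (h : f ≫ b = a ≫ g) (hQ : IsExact Q) (hS : IsExact S)
    (hfib : IsExact (ifiber f g a b h)) : WeaklyEquivalent P (loops T) :=
  -- The zigzag is `P ← hofib f → hofib g ← loops T`.
  .trans _ _ _ (.symm _ _ (weaklyEquivalent_of_quasiIso _ (quasiIso_hofibFst f hQ)))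
    (.trans _ _ _ (weaklyEquivalent_of_quasiIso _ (quasiIso_of_isExact_hofib _ hfib))
      (.symm _ _ (weaklyEquivalent_of_quasiIso _ (quasiIso_hofibInr g hS))))

end Complexes

/-! ### The initial factorization as unit for the coproduct. -/

section CoprodUnder

variable {C : Type u} [Category.{v} C] [HasPushouts C] {k B : C} {η : k ⟶ B}

theorem pushout_desc_id_inr {x : C} (i : k ⟶ x) :
    pushout.desc i (𝟙 x) (by simp) ≫ pushout.inr (𝟙 k) i = 𝟙 (pushout (𝟙 k) i) := by
  apply pushout.hom_ext
  · rw [pushout.inl_desc_assoc, ← pushout.condition, Category.id_comp, Category.comp_id]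
  · rw [pushout.inr_desc_assoc, Category.id_comp, Category.comp_id]

theorem pushout_desc_id_inl {x : C} (i : k ⟶ x) :
    pushout.desc (𝟙 x) i (by simp) ≫ pushout.inl i (𝟙 k) = 𝟙 (pushout i (𝟙 k)) := by
  apply pushout.hom_ext
  · rw [pushout.inl_desc_assoc, Category.id_comp, Category.comp_id]
  · rw [pushout.inr_desc_assoc, pushout.condition, Category.id_comp, Category.comp_id]

/-- The composites `a'`, `b'` are free so that the structure maps to `B` can be substituted for
them. -/
theorem pushout_desc_comp {x y z t : C} {i : k ⟶ x} {j : k ⟶ y} (a : x ⟶ z) (b : y ⟶ z)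
    (c : z ⟶ t) {a' : x ⟶ t} {b' : y ⟶ t} (h : i ≫ a = j ≫ b) (ha : a ≫ c = a')
    (hb : b ≫ c = b') :
    pushout.desc a b h ≫ c =
      pushout.desc a' b' (by rw [← ha, ← hb, reassoc_of% h]) := by
  apply pushout.hom_ext
  · rw [pushout.inl_desc_assoc, pushout.inl_desc, ha]
  · rw [pushout.inr_desc_assoc, pushout.inr_desc, hb]

/-- The initial factorization is a left unit for `coprodUnder`. -/
noncomputable def coprodUnderInitialLeft (X : Factorisation η) :
    coprodUnder Factorisation.initial X ≅ X where
  hom :=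
    -- The leg is given explicitly: the structure map of `Factorisation.initial` is `𝟙 k` only after
    -- unfolding.
    { h := pushout.desc (f := 𝟙 k) X.ι (𝟙 _) (by rw [Category.id_comp, Category.comp_id])
      ι_h := (Category.assoc _ _ _).trans
        ((Category.id_comp _).trans (pushout.inl_desc (f := 𝟙 k) X.ι (𝟙 _) _))
      h_π := pushout_desc_comp (i := 𝟙 k) _ _ _ _ X.ι_π (Category.id_comp _) }
  inv :=
    { h := pushout.inr (𝟙 k) X.ι
      ι_h := pushout.condition.symm
      h_π := pushout.inr_desc (f := 𝟙 k) η X.π _ }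
  hom_inv_id := Factorisation.Hom.ext (pushout_desc_id_inr X.ι)
  inv_hom_id := Factorisation.Hom.ext (pushout.inr_desc (f := 𝟙 k) X.ι (𝟙 _) _)

/-- The initial factorization is a right unit for `coprodUnder`. -/
noncomputable def coprodUnderInitialRight (X : Factorisation η) :
    coprodUnder X Factorisation.initial ≅ X where
  hom :=
    { h := pushout.desc (g := 𝟙 k) (𝟙 _) X.ι (by rw [Category.id_comp, Category.comp_id])
      ι_h := (Category.assoc _ _ _).trans
        ((congrArg (X.ι ≫ ·) (pushout.inl_desc (g := 𝟙 k) (𝟙 _) X.ι _)).trans (Category.comp_id _))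
      h_π := pushout_desc_comp (j := 𝟙 k) _ _ _ _ (Category.id_comp _) X.ι_π }
  inv :=
    { h := pushout.inl X.ι (𝟙 k)
      ι_h := rfl
      h_π := pushout.inl_desc (g := 𝟙 k) X.π η _ }
  hom_inv_id := Factorisation.Hom.ext (pushout_desc_id_inl X.ι)
  inv_hom_id := Factorisation.Hom.ext (pushout.inl_desc (g := 𝟙 k) (𝟙 _) X.ι _)

end CoprodUnder

end DiscreteCalculus

theorem mainTheorem6 {C : Type u} [Category.{v} C] [ModelCategory C]
    [SimplicialCategory C] [DiscreteCalculus.SimplicialModelCategory C]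
    {R : Type r} [CommRing R] {k B : C} (η : k ⟶ B)
    (F : Factorisation η ⥤ DiscreteCalculus.Ch.{w} R)
    (hred : DiscreteCalculus.IsReduced F) (hdeg : DiscreteCalculus.IsDegreeOne F) :
    DiscreteCalculus.WeaklyEquivalent (F.obj Factorisation.initial)
      (DiscreteCalculus.loops
        (F.obj (DiscreteCalculus.coprodUnder Factorisation.terminal Factorisation.terminal))) := by
  refine .trans _ _ _ (.symm _ _ (DiscreteCalculus.weaklyEquivalent_of_iso
      (F.mapIso (DiscreteCalculus.coprodUnderInitialLeft Factorisation.initial))))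
    (DiscreteCalculus.weaklyEquivalent_loops_of_ifiber _ _ _ _ _ ?_ ?_
      (hdeg Factorisation.initial Factorisation.initial).isExact)
  -- The corner `F(B ⨿_k k) ≅ F(B)`; the next one is `F(k ⨿_k B)`.
  · exact DiscreteCalculus.WeaklyEquivalent.isExact (.trans _ _ _
      (DiscreteCalculus.weaklyEquivalent_of_iso (F.mapIso
        (DiscreteCalculus.coprodUnderInitialRight Factorisation.terminal))) hred)
  · exact DiscreteCalculus.WeaklyEquivalent.isExact (.trans _ _ _
      (DiscreteCalculus.weaklyEquivalent_of_iso (F.mapIso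
        (DiscreteCalculus.coprodUnderInitialLeft Factorisation.terminal))) hred)
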